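/- Let $\mathbb{K}$ be an algebraically closed field of characteristic $0$. A Hom-Lie algebra over $\mathbb K$ is a triple $(\mathfrak g,[\cdot,\cdot],\alpha)$ where $\mathfrak g$ is a $\mathbb K$-vector space, $[\cdot,\cdot]$ is a skew-symmetric bilinear bracket on $\mathfrak g$ and $\alpha$ is a linear endomorphism of $\mathfrak g$ with $[\alpha(x),[y,z]]+[\alpha(y),[z,x]]+[\alpha(z),[x,y]]=0$ for all $x,y,z$. An ideal is a subspace $I$ with $[I,\mathfrak g]\subseteq I$ and $\alpha(I)\subseteq I$; the Hom-Lie algebra is simple if its bracket is not identically zero and its only ideals are $\{0\}$ and $\mathfrak g$. (1) Let $(\mathfrak g,[\cdot,\cdot],\theta)$ be a simple Hom-Lie algebra such that $\theta^2=\mathrm{id}$ and $\theta([x,y])=[\theta(x),\theta(y)]$ for all $x,y$. Let $\mathfrak g_\theta$ be the Lie algebra with underlying space $\mathfrak g$ and bracket $[x,y]_\theta=[\theta(x),\theta(y)]$. Then either $\mathfrak g_\theta$ is a simple Lie algebra, or $\mathfrak g_\theta$ is not simple but semisimple, and $\mathfrak g_\theta=S\oplus\theta(S)$ for some ideal $S$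 of $\mathfrak g_\theta$ that is a simple Lie algebra, where $\theta(S)$ is an ideal of $\mathfrak g_\theta$ too. (2) In the situation of (1), assume that $\mathfrak g$ is finite-dimensional, and put $B(x,y)=\operatorname{tr}(\rho(x)\rho(y))$, where $\rho(x)=[x,\cdot\,]$. Then $B$ is a quadratic structure on $(\mathfrak g,[\cdot,\cdot],\theta)$, that is, a symmetric nondegenerate bilinear form with $B([x,y],z)=B(x,[y,z])$ and $B(\theta(x),y)=B(x,\theta(y))$ for all $x,y,z$. Moreover $B(x,y)=\mathcal K(\theta(x),y)$ for all $x,y$, where $\mathcal K$ is the Killing form of $\mathfrak g_\theta$. (3) Conversely, let $(L,[\cdot,\cdot])$ be a simple Lie algebra over $\mathbb K$ and $\theta$ an automorphism of $L$ with $\theta^2=\mathrm{id}$. Then $(L,\theta\circ[\cdot,\cdot],\theta)$ is a simple Hom-Lie algebra, and its twist map $\theta$ is an involution that preserves its bracket. -/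

import Mathlib

/-- A Hom-Lie algebra `(V, [·,·], α)` over a field `K`. -/
structure HomLieAlgebra (K V : Type*) [Field K] [AddCommGroup V] [Module K V] where
  /-- the bilinear bracket `[·,·]` -/
  bracket : V →ₗ[K] V →ₗ[K] V
  /-- the twist map `α` -/
  twist : V →ₗ[K] V
  skew : ∀ x y, bracket x y = - bracket y x
  hom_jacobi : ∀ x y z, bracket (twist x) (bracket y z) + bracket (twist y) (bracket z x)
    + bracket (twist z) (bracket x y) = 0

namespace HomLieAlgebra

section

variable {K V : Type*} [Field K] [AddCommGroup V] [Module K V]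

/-- `α [x, y] = [α x, α y]`. -/
def IsMultiplicative (g : HomLieAlgebra K V) : Prop :=
  ∀ x y, g.twist (g.bracket x y) = g.bracket (g.twist x) (g.twist y)

/-- `α² = id`. -/
def IsInvolutive (g : HomLieAlgebra K V) : Prop :=
  ∀ x, g.twist (g.twist x) = x

/-- A subspace `I` with `[I, V] ⊆ I` and `α(I) ⊆ I`. -/
def IsIdeal (g : HomLieAlgebra K V) (I : Submodule K V) : Prop :=
  (∀ x ∈ I, ∀ y, g.bracket x y ∈ I) ∧ ∀ x ∈ I, g.twist x ∈ I

/-- The bracket is not identically zero and the only ideals are `0` and the whole space. -/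
def IsSimple (g : HomLieAlgebra K V) : Prop :=
  (∃ x y, g.bracket x y ≠ 0) ∧ ∀ I : Submodule K V, g.IsIdeal I → I = ⊥ ∨ I = ⊤

/-- `B` is a quadratic structure on `g`: a symmetric nondegenerate bilinear form that is
invariant and for which the twist map is symmetric. -/
structure IsQuadratic (g : HomLieAlgebra K V) (B : LinearMap.BilinForm K V) : Prop where
  symm : ∀ x y, B x y = B y x
  nondegenerate : B.Nondegenerate
  invariant : ∀ x y z, B (g.bracket x y) z = B x (g.bracket y z)
  twist_symm : ∀ x y, B (g.twist x) y = B x (g.twist y)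

/-- The form `B(x, y) = tr (ρ(x) ρ(y))`, where `ρ(x) = [x, ·]`. -/
noncomputable def traceForm (g : HomLieAlgebra K V) : LinearMap.BilinForm K V :=
  ((LinearMap.mul K (Module.End K V)).compl₁₂ g.bracket g.bracket).compr₂ (LinearMap.trace K V)

theorem traceForm_apply (g : HomLieAlgebra K V) (x y : V) :
    g.traceForm x y = LinearMap.trace K V (g.bracket x ∘ₗ g.bracket y) := rfl

/-- The underlying space of the Lie algebra `g_θ` attached to an involutive multiplicative
Hom-Lie algebra `g = (V, [·,·], θ)`; it is `V` itself, with the bracket `[x, y]_θ = [θ x, θ y]`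
(which is `θ⁻¹ [x, y]`). -/
@[nolint unusedArguments]
def AssocLie (g : HomLieAlgebra K V) (_hm : g.IsMultiplicative) (_hi : g.IsInvolutive) : Type _ :=
  V

variable (g : HomLieAlgebra K V) (hm : g.IsMultiplicative) (hi : g.IsInvolutive)

instance : AddCommGroup (g.AssocLie hm hi) := inferInstanceAs (AddCommGroup V)

instance : Module K (g.AssocLie hm hi) := inferInstanceAs (Module K V)

/-- The identity map from `V` to the underlying space of `g_θ`. -/
def toAssocLie : V ≃ₗ[K] g.AssocLie hm hi := LinearEquiv.refl K V

/-- The map `θ`, regarded as a linear map on `g_θ`. -/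
def assocTwist : g.AssocLie hm hi →ₗ[K] g.AssocLie hm hi :=
  (g.toAssocLie hm hi).conj g.twist

instance : Bracket (g.AssocLie hm hi) (g.AssocLie hm hi) where
  bracket x y := g.toAssocLie hm hi (g.bracket (g.twist ((g.toAssocLie hm hi).symm x))
    (g.twist ((g.toAssocLie hm hi).symm y)))

theorem assocLie_lie_def (x y : g.AssocLie hm hi) :
    ⁅x, y⁆ = g.toAssocLie hm hi (g.bracket (g.twist ((g.toAssocLie hm hi).symm x))
      (g.twist ((g.toAssocLie hm hi).symm y))) := rfl

theorem assocLie_bracket (x y : V) :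
    ⁅g.toAssocLie hm hi x, g.toAssocLie hm hi y⁆ =
      g.toAssocLie hm hi (g.bracket (g.twist x) (g.twist y)) := rfl

instance [CharZero K] : LieRing (g.AssocLie hm hi) where
  add_lie x y z := by
    simp only [assocLie_lie_def, map_add, LinearMap.add_apply]
  lie_add x y z := by
    simp only [assocLie_lie_def, map_add]
  lie_self x := by
    have h : (2 : K) • g.bracket (g.twist x) (g.twist x) = 0 := by
      rw [two_smul]
      exact add_eq_zero_iff_eq_neg.mpr (g.skew _ _)
    exact (smul_eq_zero.mp h).resolve_left two_ne_zero
  leibniz_lie x y z := by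
    change g.bracket (g.twist x) (g.twist (g.bracket (g.twist y) (g.twist z))) =
      g.bracket (g.twist (g.bracket (g.twist x) (g.twist y))) (g.twist z) +
      g.bracket (g.twist y) (g.twist (g.bracket (g.twist x) (g.twist z)))
    have e : ∀ a b : V, g.twist (g.bracket (g.twist a) (g.twist b)) = g.bracket a b := by
      intro a b
      rw [hm, hi, hi]
    rw [e y z, e x y, e x z]
    have h := g.hom_jacobi x y z
    rw [g.skew z x, map_neg, g.skew (g.twist z)] at h
    have h' : g.bracket (g.twist x) (g.bracket y z) -
        (g.bracket (g.bracket x y) (g.twist z) + g.bracket (g.twist y) (g.bracket x z)) = 0 := by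
      rw [← h]
      abel
    exact sub_eq_zero.mp h'

instance [CharZero K] : LieAlgebra K (g.AssocLie hm hi) where
  lie_smul t x y := by
    simp only [assocLie_lie_def, map_smul]

end

/-- The Hom-Lie algebra `(L, θ ∘ [·,·], θ)` obtained from a Lie algebra `L` and an
endomorphism `θ` of `L` by composition. -/
def ofLie {K L : Type*} [Field K] [LieRing L] [LieAlgebra K L] (θ : L →ₗ⁅K⁆ L) :
    HomLieAlgebra K L where
  bracket := (LieModule.toEnd K L L : L →ₗ[K] Module.End K L).compr₂ (θ : L →ₗ[K] L)
  twist := θ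
  skew x y := by
    change θ ⁅x, y⁆ = - θ ⁅y, x⁆
    rw [← lie_skew, map_neg]
  hom_jacobi x y z := by
    change θ ⁅θ x, θ ⁅y, z⁆⁆ + θ ⁅θ y, θ ⁅z, x⁆⁆ + θ ⁅θ z, θ ⁅x, y⁆⁆ = 0
    simp only [← LieHom.map_lie, ← map_add, lie_jacobi, map_zero]

theorem ofLie_bracket {K L : Type*} [Field K] [LieRing L] [LieAlgebra K L] (θ : L →ₗ⁅K⁆ L)
    (x y : L) : (ofLie θ).bracket x y = θ ⁅x, y⁆ := rfl

end HomLieAlgebra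

/-!
Ideals of an involutive multiplicative Hom-Lie algebra `(g, θ)` are the `θ`-stable ideals of
`g_θ`. So if `g` is simple, every ideal `I` of `g_θ` other than `0` and `g_θ` satisfies
`I ∩ θ(I) = 0` and `I + θ(I) = g_θ`, these two subspaces being `θ`-stable ideals. The centre of
`g_θ` is also `θ`-stable, hence zero. An abelian ideal commutes with its complement as well as with
itself, and a minimal ideal other than `I` and `θ(I)` commutes with both, so either would be
central: thus `I` and `θ(I)` are non-abelian and are the only minimal ideals.

Since `[x, [y, z]] = [θ x, [y, z]_θ]_θ`, the form `B` is the Killing form twisted by `θ` in one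
variable. The symmetry of `B` then says that `θ` is symmetric for the Killing form, and the
remaining properties of `B` follow from invariance of the Killing form and Cartan's criterion.
-/

section

variable {R L : Type*} [CommRing R] [LieRing L] [LieAlgebra R L]

theorem lie_eq_bot_of_disjoint {I J : LieIdeal R L} (h : Disjoint I J) : ⁅I, J⁆ = ⊥ :=
  le_bot_iff.mp ((LieSubmodule.lie_le_inf I J).trans h.le_bot)

theorem le_center_of_codisjoint {A I J : LieIdeal R L} (h : Codisjoint I J) (hI : ⁅I, A⁆ = ⊥)
    (hJ : ⁅J, A⁆ = ⊥) :
    A ≤ LieAlgebra.center R L := by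
  rw [LieAlgebra.center, LieModule.le_max_triv_iff_bracket_eq_bot, ← h.eq_top,
    LieSubmodule.sup_lie, hI, hJ, sup_bot_eq]

theorem center_le_comap_center {L' : Type*} [LieRing L'] [LieAlgebra R L'] {f : L →ₗ⁅R⁆ L'}
    (hf : Function.Surjective f) :
    LieAlgebra.center R L ≤ (LieAlgebra.center R L').comap f := by
  intro x hx
  rw [LieIdeal.mem_comap, LieModule.mem_maxTrivSubmodule]
  intro y
  obtain ⟨z, rfl⟩ := hf y
  rw [← LieHom.map_lie, (LieModule.mem_maxTrivSubmodule R L L x).mp hx, map_zero]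

theorem exists_ne_bot_ne_top_of_not_isSimple (hab : ¬ IsLieAbelian L)
    (hs : ¬ LieAlgebra.IsSimple R L) : ∃ I : LieIdeal R L, I ≠ ⊥ ∧ I ≠ ⊤ := by
  contrapose! hs
  exact ⟨fun I => or_iff_not_imp_left.mpr (hs I), hab⟩

/-- A Lie algebra with an endomorphism `θ` is twist-simple if it is non-abelian and has no
`θ`-stable ideals other than `⊥` and `⊤`. For an involutive `θ` this is the property of `g_θ`
that corresponds to simplicity of the Hom-Lie algebra `g`. -/
structure IsTwistSimple (θ : L →ₗ⁅R⁆ L) : Prop where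
  non_abelian : ¬ IsLieAbelian L
  eq_bot_or_eq_top : ∀ I : LieIdeal R L, I ≤ I.comap θ → I = ⊥ ∨ I = ⊤

theorem isTwistSimple_of_isSimple (θ : L →ₗ⁅R⁆ L) [h : LieAlgebra.IsSimple R L] :
    IsTwistSimple θ :=
  ⟨h.non_abelian, fun I _ => h.eq_bot_or_eq_top I⟩

namespace IsTwistSimple

variable {θ : L →ₗ⁅R⁆ L} {I : LieIdeal R L}

theorem center_eq_bot (h : IsTwistSimple θ) (hθ : Function.Surjective θ) :
    LieAlgebra.center R L = ⊥ :=
  (h.eq_bot_or_eq_top _ (center_le_comap_center hθ)).resolve_right fun htop =>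
    h.non_abelian ((LieAlgebra.isLieAbelian_iff_center_eq_top R L).mpr htop)

theorem isCompl_comap (h : IsTwistSimple θ) (hθ : Function.Involutive θ) (hbot : I ≠ ⊥)
    (htop : I ≠ ⊤) : IsCompl I (I.comap θ) := by
  have hI : I ≤ (I.comap θ).comap θ := fun x hx => by
    rwa [LieIdeal.mem_comap, LieIdeal.mem_comap, hθ x]
  have hinf : I ⊓ I.comap θ ≤ (I ⊓ I.comap θ).comap θ := fun _ hx => ⟨hx.2, hI hx.1⟩
  have hsup : I ⊔ I.comap θ ≤ (I ⊔ I.comap θ).comap θ :=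
    sup_le (hI.trans (LieIdeal.comap_mono le_sup_right)) (LieIdeal.comap_mono le_sup_left)
  exact .of_eq
    ((h.eq_bot_or_eq_top _ hinf).resolve_right fun he => htop (inf_eq_top_iff.mp he).1)
    ((h.eq_bot_or_eq_top _ hsup).resolve_left fun he => hbot (sup_eq_bot_iff.mp he).1)

theorem isAtom (h : IsTwistSimple θ) (hθ : Function.Involutive θ) (hbot : I ≠ ⊥)
    (htop : I ≠ ⊤) : IsAtom I := by
  refine ⟨hbot, fun J hJ => by_contra fun hJbot => hJ.ne ?_⟩
  have hIθ := h.isCompl_comap hθ hbot htop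
  have hJθ := h.isCompl_comap hθ hJbot (hJ.trans_le le_top).ne
  refine eq_of_le_of_inf_le_of_sup_le hJ.le (z := J.comap θ) ?_ ?_
  · exact (inf_le_inf_left I (LieIdeal.comap_mono hJ.le)).trans (hIθ.inf_eq_bot.le.trans bot_le)
  · exact le_top.trans hJθ.sup_eq_top.ge

theorem exists_isCompl (h : IsTwistSimple θ) (hθ : Function.Involutive θ) (I : LieIdeal R L) :
    ∃ J, IsCompl I J := by
  by_cases hbot : I = ⊥
  · exact ⟨⊤, hbot ▸ isCompl_bot_top⟩
  by_cases htop : I = ⊤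
  · exact ⟨⊥, htop ▸ isCompl_top_bot⟩
  exact ⟨I.comap θ, h.isCompl_comap hθ hbot htop⟩

theorem not_isLieAbelian (h : IsTwistSimple θ) (hθ : Function.Involutive θ) (hbot : I ≠ ⊥) :
    ¬ IsLieAbelian I := by
  intro hI
  obtain ⟨J, hIJ⟩ := h.exists_isCompl hθ I
  have hcenter : I ≤ LieAlgebra.center R L := le_center_of_codisjoint hIJ.codisjoint
    ((LieSubmodule.lie_abelian_iff_lie_self_eq_bot I).mp hI)
    (lie_eq_bot_of_disjoint hIJ.disjoint.symm)
  exact hbot (le_bot_iff.mp (h.center_eq_bot hθ.surjective ▸ hcenter))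

theorem isAtom_iff (h : IsTwistSimple θ) (hθ : Function.Involutive θ) (hbot : I ≠ ⊥)
    (htop : I ≠ ⊤) (A : LieIdeal R L) : IsAtom A ↔ A = I ∨ A = I.comap θ := by
  have hIθ := h.isCompl_comap hθ hbot htop
  have hI : IsAtom I := h.isAtom hθ hbot htop
  have hθI : IsAtom (I.comap θ) := h.isAtom hθ
    (fun he => htop (by simpa [he] using hIθ.sup_eq_top))
    (fun he => hbot (by simpa [he] using hIθ.inf_eq_bot))
  refine ⟨fun hA => ?_, by rintro (rfl | rfl) <;> assumption⟩
  by_contra! hne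
  have hcenter : A ≤ LieAlgebra.center R L := le_center_of_codisjoint hIθ.codisjoint
    (lie_eq_bot_of_disjoint (hI.disjoint_of_ne hA hne.1.symm))
    (lie_eq_bot_of_disjoint (hθI.disjoint_of_ne hA hne.2.symm))
  exact hA.1 (le_bot_iff.mp (h.center_eq_bot hθ.surjective ▸ hcenter))

theorem isSemisimple_of_ne_bot_of_ne_top (h : IsTwistSimple θ) (hθ : Function.Involutive θ)
    (hbot : I ≠ ⊥) (htop : I ≠ ⊤) : LieAlgebra.IsSemisimple R L := by
  have hIθ := h.isCompl_comap hθ hbot htop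
  have hatoms : {A : LieIdeal R L | IsAtom A} = {I, I.comap θ} :=
    Set.ext (h.isAtom_iff hθ hbot htop)
  refine ⟨?_, ?_, fun A hA => h.not_isLieAbelian hθ hA.1⟩
  · rw [hatoms, sSup_pair, hIθ.sup_eq_top]
  · rw [hatoms, sSupIndep_pair (hIθ.disjoint.ne hbot)]
    exact hIθ.disjoint

theorem isSemisimple (h : IsTwistSimple θ) (hθ : Function.Involutive θ) :
    LieAlgebra.IsSemisimple R L := by
  by_cases hs : LieAlgebra.IsSimple R L
  · infer_instance
  · obtain ⟨I, hbot, htop⟩ := exists_ne_bot_ne_top_of_not_isSimple h.non_abelian hs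
    exact h.isSemisimple_of_ne_bot_of_ne_top hθ hbot htop

theorem exists_isSimple_isCompl_map (h : IsTwistSimple θ) (hθ : Function.Involutive θ)
    (hs : ¬ LieAlgebra.IsSimple R L) :
    ∃ S T : LieIdeal R L, LieAlgebra.IsSimple R S ∧
      T.toSubmodule = S.toSubmodule.map (θ : L →ₗ[R] L) ∧
      IsCompl S.toSubmodule T.toSubmodule := by
  obtain ⟨S, hbot, htop⟩ := exists_ne_bot_ne_top_of_not_isSimple h.non_abelian hs
  have := h.isSemisimple hθ
  refine ⟨S, S.comap θ, LieAlgebra.IsSemisimple.isSimple_of_isAtom S (h.isAtom hθ hbot htop),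
    ?_, LieSubmodule.isCompl_toSubmodule.mpr (h.isCompl_comap hθ hbot htop)⟩
  exact SetLike.coe_injective
    (congrFun (Set.image_eq_preimage_of_inverse hθ.leftInverse hθ.rightInverse) S).symm

end IsTwistSimple

end

namespace HomLieAlgebra

section

variable {K V : Type*} [Field K] [AddCommGroup V] [Module K V]
  {g : HomLieAlgebra K V} {hm : g.IsMultiplicative} {hi : g.IsInvolutive}

theorem toAssocLie_bracket (x y : V) :
    g.toAssocLie hm hi (g.bracket x y) =
      ⁅g.toAssocLie hm hi (g.twist x), g.toAssocLie hm hi (g.twist y)⁆ := by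
  rw [assocLie_bracket, hi, hi]

theorem toAssocLie_twist_bracket (x y : V) :
    g.toAssocLie hm hi (g.twist (g.bracket x y)) =
      ⁅g.toAssocLie hm hi x, g.toAssocLie hm hi y⁆ := by
  rw [assocLie_bracket, hm]

theorem traceForm_comm (g : HomLieAlgebra K V) (x y : V) : g.traceForm x y = g.traceForm y x :=
  LinearMap.trace_mul_comm K (g.bracket x) (g.bracket y)

variable [CharZero K]

variable (g hm hi) in
/-- The twist map `θ` of an involutive multiplicative Hom-Lie algebra, as an endomorphism of the
Lie algebra `g_θ`. -/
def assocTwistHom : g.AssocLie hm hi →ₗ⁅K⁆ g.AssocLie hm hi where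
  __ := g.assocTwist hm hi
  map_lie' {x y} := hm (g.twist x) (g.twist y)

theorem assocTwistHom_involutive : Function.Involutive (g.assocTwistHom hm hi) := hi

theorem isIdeal_comap_toAssocLie {I : LieIdeal K (g.AssocLie hm hi)}
    (hI : I ≤ I.comap (g.assocTwistHom hm hi)) :
    g.IsIdeal (I.toSubmodule.comap (g.toAssocLie hm hi).toLinearMap) := by
  refine ⟨fun x hx y => ?_, fun _ hx => hI hx⟩
  change g.toAssocLie hm hi (g.bracket x y) ∈ I
  rw [toAssocLie_bracket]
  exact lie_mem_left K _ I _ _ (hI hx)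

theorem IsSimple.isTwistSimple (hs : g.IsSimple) : IsTwistSimple (g.assocTwistHom hm hi) where
  non_abelian hab := by
    obtain ⟨x, y, hxy⟩ := hs.1
    refine hxy ((g.toAssocLie hm hi).map_eq_zero_iff.mp ?_)
    rw [toAssocLie_bracket, trivial_lie_zero]
  eq_bot_or_eq_top I hI := by
    simpa only [Submodule.comap_equiv_eq_map_symm, Submodule.map_eq_bot_iff,
      Submodule.map_eq_top_iff, LieSubmodule.toSubmodule_eq_bot, LieSubmodule.toSubmodule_eq_top]
      using hs.2 _ (isIdeal_comap_toAssocLie hI)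

variable (hm hi)

theorem traceForm_eq_killingForm (x y : V) :
    g.traceForm x y = killingForm K (g.AssocLie hm hi)
      (g.toAssocLie hm hi (g.twist x)) (g.toAssocLie hm hi y) := by
  have hconj : (g.toAssocLie hm hi).conj (g.bracket x ∘ₗ g.bracket y) =
      LieAlgebra.ad K (g.AssocLie hm hi) (g.toAssocLie hm hi (g.twist x)) ∘ₗ
        LieAlgebra.ad K (g.AssocLie hm hi) (g.toAssocLie hm hi y) := by
    refine LinearMap.ext fun w => ?_
    obtain ⟨z, rfl⟩ := (g.toAssocLie hm hi).surjective w
    simp only [LinearMap.comp_apply, LieAlgebra.ad_apply, LinearEquiv.conj_apply_apply,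
      LinearEquiv.symm_apply_apply, toAssocLie_bracket, ← toAssocLie_twist_bracket]
  rw [traceForm_apply, killingForm_apply_apply, ← hconj, LinearMap.trace_conj']

theorem killingForm_twist (x y : V) :
    killingForm K (g.AssocLie hm hi) (g.toAssocLie hm hi (g.twist x)) (g.toAssocLie hm hi y) =
      killingForm K (g.AssocLie hm hi) (g.toAssocLie hm hi x)
        (g.toAssocLie hm hi (g.twist y)) := by
  rw [← traceForm_eq_killingForm, traceForm_comm, traceForm_eq_killingForm hm hi,
    LieModule.traceForm_comm]

include hm hi in
theorem traceForm_bracket_left (x y z : V) :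
    g.traceForm (g.bracket x y) z = g.traceForm x (g.bracket y z) := by
  simp only [traceForm_eq_killingForm hm hi]
  rw [toAssocLie_twist_bracket, killingForm_twist, toAssocLie_twist_bracket]
  exact LieModule.traceForm_apply_lie_apply K _ _ _ _ _

include hm hi in
theorem traceForm_twist_left (x y : V) :
    g.traceForm (g.twist x) y = g.traceForm x (g.twist y) := by
  rw [traceForm_eq_killingForm hm hi, traceForm_eq_killingForm hm hi, killingForm_twist]

theorem traceForm_nondegenerate [LieAlgebra.IsKilling K (g.AssocLie hm hi)] :
    g.traceForm.Nondegenerate := by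
  have hsymm : LinearMap.IsRefl g.traceForm := fun x y h => (g.traceForm_comm y x).trans h
  refine hsymm.nondegenerate_iff_separatingLeft.mpr fun x hx => ?_
  have hzero : g.toAssocLie hm hi (g.twist x) = 0 :=
    (LieAlgebra.IsKilling.killingForm_nondegenerate K (g.AssocLie hm hi)).1 _ fun y =>
      (traceForm_eq_killingForm hm hi x ((g.toAssocLie hm hi).symm y)).symm.trans (hx _)
  rw [← hi x, (g.toAssocLie hm hi).map_eq_zero_iff.mp hzero, map_zero]

theorem isQuadratic_traceForm [LieAlgebra.IsKilling K (g.AssocLie hm hi)] :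
    g.IsQuadratic g.traceForm where
  symm := g.traceForm_comm
  nondegenerate := traceForm_nondegenerate hm hi
  invariant := traceForm_bracket_left hm hi
  twist_symm := traceForm_twist_left hm hi

include hm hi in
theorem IsSimple.isQuadratic_traceForm [FiniteDimensional K V] (hs : g.IsSimple) :
    g.IsQuadratic g.traceForm := by
  have : FiniteDimensional K (g.AssocLie hm hi) := ‹FiniteDimensional K V›
  have : LieAlgebra.IsSemisimple K (g.AssocLie hm hi) :=
    hs.isTwistSimple.isSemisimple assocTwistHom_involutive
  exact HomLieAlgebra.isQuadratic_traceForm hm hi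

end

section

variable {K L : Type*} [Field K] [LieRing L] [LieAlgebra K L] {θ : L →ₗ⁅K⁆ L}

theorem isMultiplicative_ofLie : (ofLie θ).IsMultiplicative :=
  fun x y => congrArg θ (θ.map_lie x y)

theorem IsIdeal.lie_mem_of_involutive (hθ : Function.Involutive θ) {I : Submodule K L}
    (hI : (ofLie θ).IsIdeal I) {x m : L} (hm : m ∈ I) : ⁅x, m⁆ ∈ I := by
  have h : θ (θ ⁅m, x⁆) ∈ I := hI.2 _ (hI.1 m hm x)
  rwa [hθ, ← lie_skew, neg_mem_iff] at h

theorem isSimple_ofLie (h : IsTwistSimple θ) (hθ : Function.Involutive θ) :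
    (ofLie θ).IsSimple := by
  refine ⟨?_, fun I hI => ?_⟩
  · by_contra! hzero
    exact h.non_abelian ⟨fun x y => hθ.injective ((hzero x y).trans (map_zero θ).symm)⟩
  · let J : LieIdeal K L := { I with lie_mem := hI.lie_mem_of_involutive hθ }
    exact (h.eq_bot_or_eq_top J hI.2).imp (congrArg LieSubmodule.toSubmodule)
      (congrArg LieSubmodule.toSubmodule)

end

end HomLieAlgebra

theorem mainTheorem4_general {K : Type*} [Field K] :
    (∀ [CharZero K] (V : Type*) [AddCommGroup V] [Module K V] (g : HomLieAlgebra K V)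
      (hm : g.IsMultiplicative) (hi : g.IsInvolutive), g.IsSimple →
      (LieAlgebra.IsSimple K (g.AssocLie hm hi) ∨
        (¬ LieAlgebra.IsSimple K (g.AssocLie hm hi) ∧
          LieAlgebra.IsSemisimple K (g.AssocLie hm hi) ∧
          ∃ S T : LieIdeal K (g.AssocLie hm hi), LieAlgebra.IsSimple K S ∧
            T.toSubmodule = S.toSubmodule.map (g.assocTwist hm hi) ∧
            IsCompl S.toSubmodule T.toSubmodule)) ∧
      (FiniteDimensional K V →
        g.IsQuadratic g.traceForm ∧
        ∀ x y : V, g.traceForm x y =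
          killingForm K (g.AssocLie hm hi)
            (g.toAssocLie hm hi (g.twist x)) (g.toAssocLie hm hi y))) ∧
    (∀ (L : Type*) [LieRing L] [LieAlgebra K L] (θ : L ≃ₗ⁅K⁆ L),
      LieAlgebra.IsSimple K L → (∀ x, θ (θ x) = x) →
      (HomLieAlgebra.ofLie (K := K) θ.toLieHom).IsMultiplicative ∧
      (HomLieAlgebra.ofLie (K := K) θ.toLieHom).IsInvolutive ∧
      (HomLieAlgebra.ofLie (K := K) θ.toLieHom).IsSimple) := by
  refine ⟨fun V _ _ g hm hi hs => ⟨or_iff_not_imp_left.mpr fun hns => ?_, fun _ => ?_⟩,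
    fun L _ _ θ _ hθ => ?_⟩
  · have htwist : IsTwistSimple (g.assocTwistHom hm hi) := hs.isTwistSimple
    have hinv := HomLieAlgebra.assocTwistHom_involutive (hm := hm) (hi := hi)
    exact ⟨hns, htwist.isSemisimple hinv, htwist.exists_isSimple_isCompl_map hinv hns⟩
  · exact ⟨hs.isQuadratic_traceForm hm hi, HomLieAlgebra.traceForm_eq_killingForm hm hi⟩
  · exact ⟨HomLieAlgebra.isMultiplicative_ofLie, hθ,
      HomLieAlgebra.isSimple_ofLie (isTwistSimple_of_isSimple _) hθ⟩

theorem mainTheorem4 {K : Type*} [Field K] [IsAlgClosed K] [CharZero K] :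
    (∀ (V : Type*) [AddCommGroup V] [Module K V] (g : HomLieAlgebra K V)
      (hm : g.IsMultiplicative) (hi : g.IsInvolutive), g.IsSimple →
      (LieAlgebra.IsSimple K (g.AssocLie hm hi) ∨
        (¬ LieAlgebra.IsSimple K (g.AssocLie hm hi) ∧
          LieAlgebra.IsSemisimple K (g.AssocLie hm hi) ∧
          ∃ S T : LieIdeal K (g.AssocLie hm hi), LieAlgebra.IsSimple K S ∧
            T.toSubmodule = S.toSubmodule.map (g.assocTwist hm hi) ∧
            IsCompl S.toSubmodule T.toSubmodule)) ∧
      (FiniteDimensional K V →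
        g.IsQuadratic g.traceForm ∧
        ∀ x y : V, g.traceForm x y =
          killingForm K (g.AssocLie hm hi)
            (g.toAssocLie hm hi (g.twist x)) (g.toAssocLie hm hi y))) ∧
    (∀ (L : Type*) [LieRing L] [LieAlgebra K L] (θ : L ≃ₗ⁅K⁆ L),
      LieAlgebra.IsSimple K L → (∀ x, θ (θ x) = x) →
      (HomLieAlgebra.ofLie (K := K) θ.toLieHom).IsMultiplicative ∧
      (HomLieAlgebra.ofLie (K := K) θ.toLieHom).IsInvolutive ∧
      (HomLieAlgebra.ofLie (K := K) θ.toLieHom).IsSimple) :=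
  mainTheorem4_general.imp_left fun h V => h V
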